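/- Let $\mathcal A$ be a finite set of assets with $|\mathcal A|>2$, and let $\mathbb R_+=[0,\infty)$. For $I\in\mathbb R_+^{\mathcal A}$ write $I>0$ if $I_A>0$ for all $A\in\mathcal A$. A trading function is a function $f:\mathbb R_+^{\mathcal A}\to\mathbb R$ that is strictly increasing in all variables on $\{I: I>0\}$ and continuous in the sense that for every $J\in\mathbb R_+^{\mathcal A}$ the sets $\{I: f(I)\ge f(J)\}$ and $\{I: f(I)\le f(J)\}$ are closed. For $\mathcal B\subseteq\mathcal A$ let $(I_{\mathcal B},J_{-\mathcal B})$ denote the inventory that agrees with $I$ on $\mathcal B$ and with $J$ on $\mathcal A\setminus\mathcal B$. Say that $f$ satisfies - independence, if for all $\mathcal B\subseteq\mathcal A$ and all $I,J>0$: $f(I_{\mathcal B},J_{-\mathcal B})=f(J)\Leftrightarrow f(I)=f(J_{\mathcal B},I_{-\mathcal B})$; - homogeneity in liquidity, if $f(\lambda I)=\lambda f(I)$ for all $I\in\mathbb R_+^{\mathcal A}$ and $\lambda>0$; - aversion to permanent loss, if $\{I\in\mathbb R_+^{\mathcal A}: f(I)\ge f(J)\}$ is convex for every $J\in\mathbb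 R_+^{\mathcal A}$; - sufficient funds, if for all $I,J\in\mathbb R_+^{\mathcal A}$ with $f(I)=f(J)$: $I>0\Rightarrow J>0$. A constant inventory elasticity market maker (CEMM) with parameter $\gamma\in\mathbb R$ is a function on $\mathbb R_+^{\mathcal A}$ of the form $$f(I)=c\Bigl(\sum_{A\in\mathcal A}\alpha_A I_A^{\gamma}\Bigr)^{1/\gamma}\ (\gamma\ne0),\qquad f(I)=c\prod_{A\in\mathcal A}I_A^{\alpha_A}\ (\gamma=0),$$ with constants $c>0$ and $\alpha_A>0$, $\sum_{A\in\mathcal A}\alpha_A=1$, where for $\gamma<0$ the value is $0$ whenever some $I_A=0$ (the continuous extension). Its inventory elasticity is $\frac1{1-\gamma}$ ($=\infty$ for $\gamma=1$), and it is called positive if $\gamma\le1$. Then for every trading function $f$: 1. $f$ satisfies independence, homogeneity in liquidity, and aversion to permanent loss if and only if $f$ is a CEMM with positive inventory elasticity (that is, with some $\gamma\le 1$). 2. $f$ satisfies independence, homogeneity in liquidity, and sufficient funds if and only if $f$ is a CEMM with inventory elasticity $0<\frac1{1-\gamma}\le1$. -/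

import Mathlib

open scoped NNReal

namespace CFMM

variable {𝒜 : Type*}

/-- An inventory: a nonnegative quantity of each asset, a point of `ℝ₊^𝒜`. -/
abbrev Inventory (𝒜 : Type*) := 𝒜 → ℝ≥0

/-- `I > 0`: every asset is held in a strictly positive quantity. -/
def AllPos (I : Inventory 𝒜) : Prop := ∀ a, 0 < I a

open Classical in
/-- The inventory `(I_B, J_{-B})`: quantities from `I` on `B` and from `J` off `B`. -/
noncomputable def mix (B : Set 𝒜) (I J : Inventory 𝒜) : Inventory 𝒜 :=
  fun a => if a ∈ B then I a else J a

/-- The standing assumptions on a trading function `f : ℝ₊^𝒜 → ℝ`: it is strictly increasing in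
all variables at strictly positive inventories, and continuous in the sense that its weak upper and
lower level sets are closed. -/
structure IsTradingFunction (f : Inventory 𝒜 → ℝ) : Prop where
  strictMono : StrictMonoOn f {I | AllPos I}
  isClosed_upper : ∀ J, IsClosed {I | f J ≤ f I}
  isClosed_lower : ∀ J, IsClosed {I | f I ≤ f J}

/-- Independence: the terms of trade for the assets in `B` do not depend on the (strictly positive)
holdings of the other assets. -/
def Independence (f : Inventory 𝒜 → ℝ) : Prop :=
  ∀ (B : Set 𝒜) (I J : Inventory 𝒜), AllPos I → AllPos J →
    (f (mix B I J) = f J ↔ f I = f (mix B J I))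

/-- Homogeneity in liquidity. -/
def HomogeneityInLiquidity (f : Inventory 𝒜 → ℝ) : Prop :=
  ∀ (I : Inventory 𝒜) (l : ℝ≥0), 0 < l → f (l • I) = l * f I

/-- Aversion to permanent loss: weak upper level sets are convex. Since inventories have
nonnegative coordinates, and the weights of a convex combination are nonnegative, convexity is taken
over the scalars `ℝ≥0`. -/
def AversionToPermanentLoss (f : Inventory 𝒜 → ℝ) : Prop :=
  ∀ J, Convex ℝ≥0 {I | f J ≤ f I}

/-- Sufficient funds: liquidity curves through positive inventories do not meet the boundary. -/
def SufficientFunds (f : Inventory 𝒜 → ℝ) : Prop :=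
  ∀ I J, f I = f J → AllPos I → AllPos J

open Classical in
/-- The constant elasticity function with parameter `γ`, scale `c` and weights `α`. For `γ < 0`
the value at an inventory with a zero coordinate is the limit `0` (where the formula itself would
involve a negative power of zero). -/
noncomputable def cemm [Fintype 𝒜] (γ c : ℝ) (α : 𝒜 → ℝ) (I : Inventory 𝒜) : ℝ :=
  if γ = 0 then c * ∏ a, (I a : ℝ) ^ α a
  else if γ < 0 ∧ ∃ a, I a = 0 then 0
  else c * (∑ a, α a * (I a : ℝ) ^ γ) ^ (1 / γ)

/-- `f` is a constant inventory elasticity market maker (CEMM) with parameter `γ`. -/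
def IsCEMM [Fintype 𝒜] (γ : ℝ) (f : Inventory 𝒜 → ℝ) : Prop :=
  ∃ (c : ℝ) (α : 𝒜 → ℝ), 0 < c ∧ (∀ a, 0 < α a) ∧ ∑ a, α a = 1 ∧ f = cemm γ c α

/-- The inventory elasticity `1 / (1 - γ)`, a real number when `γ ≠ 1`; it is infinite when
`γ = 1`. -/
noncomputable def inventoryElasticity (γ : ℝ) : ℝ := 1 / (1 - γ)

/-- Positive inventory elasticity means `γ ≤ 1`; the case `γ = 1` of infinite elasticity is
included. -/
def PositiveElasticity (γ : ℝ) : Prop := γ ≤ 1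

end CFMM

/-! In log-inventories put `F x = log (f (exp x))`. Homogeneity makes `F` equivariant under uniform
shifts, and independence makes trade-offs within a pair of coordinates blind to the others. The pair
`(i, j)` is therefore governed by one function of the log-ratio, `φ_ij = pairMean F i j`. It is
increasing and 1-Lipschitz, and its derivative `p` lies in `[0, 1]`; the odds `p / (1 - p)` are a
marginal rate of substitution.

Marginal rates multiply along `i → j → k` (`hasDerivAt_pairMean_trans`). With a third asset, this
and the Steinhaus theorem exclude the values 0 and 1, and almost everywhere differentiability of
Lipschitz functions becomes differentiability everywhere. The log-odds then satisfy a Cauchy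
equation, so they equal `A i - A j + γ * d` with a common slope `γ`. Integrating gives the utility
`∑ α a * crra γ (I a)`: trades within a pair that preserve it preserve `F`, and finitely many such
trades lead to a constant inventory. Hence `f` is a CEMM at positive inventories, and by continuity
everywhere.

It remains to see which `γ` each extra axiom allows: convexity of upper level sets means `γ ≤ 1`, by
concavity of `crra γ` and a test on the axes; sufficient funds means `γ ≤ 0`, since a CEMM vanishes
on the boundary exactly then. -/

namespace CFMM

open Function Set Filter Topology MeasureTheory

/-! ### Relative means of pairs in log coordinates. -/

variable {ι : Type*} [DecidableEq ι] {F : (ι → ℝ) → ℝ} {i j k : ι}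

/-- The point `z` with coordinates `i` and `j` replaced by `x` and `y`. -/
def setPair (z : ι → ℝ) (i : ι) (x : ℝ) (j : ι) (y : ℝ) : ι → ℝ :=
  update (update z i x) j y

/-- A strictly increasing function of log-inventories, equivariant under uniform shifts, for which
the terms of trade of any pair of coordinates do not depend on the other coordinates. -/
structure ShiftSeparable (F : (ι → ℝ) → ℝ) : Prop where
  strictMono : StrictMono F
  shift : ∀ x t, F (fun a => x a + t) = F x + t
  indep : ∀ i j, i ≠ j → ∀ x y x' y' z w,
    F (setPair z i x j y) = F (setPair z i x' j y') →
      F (setPair w i x j y) = F (setPair w i x' j y')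

theorem setPair_comm (h : i ≠ j) (z : ι → ℝ) (x y : ℝ) :
    setPair z i x j y = setPair z j y i x := by
  unfold setPair; rw [update_comm h]

theorem setPair_add (z : ι → ℝ) (x y t : ℝ) :
    (fun a => setPair z i x j y a + t) = setPair (fun a => z a + t) i (x + t) j (y + t) := by
  funext a; unfold setPair update; simp only [eq_rec_constant]; split_ifs <;> rfl

theorem setPair_lt_left (h : i ≠ j) (z : ι → ℝ) {x x' : ℝ} (y : ℝ) (hx : x < x') :
    setPair z i x j y < setPair z i x' j y := by
  rw [setPair_comm h, setPair_comm h]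
  exact update_lt_update_iff.2 hx

theorem setPair_lt_right (z : ι → ℝ) (x : ℝ) {y y' : ℝ} (hy : y < y') :
    setPair z i x j y < setPair z i x j y' :=
  update_lt_update_iff.2 hy

theorem setPair_self (z : ι → ℝ) : setPair z i (z i) j (z j) = z := by
  simp [setPair]

/-- The relative mean of coordinates `i` and `j`: the common value that is worth as much as the
pair `(d, 0)`. -/
noncomputable def pairMean (F : (ι → ℝ) → ℝ) (i j : ι) (d : ℝ) : ℝ :=
  Classical.epsilon fun t => F (setPair 0 i t j t) = F (setPair 0 i d j 0)

namespace ShiftSeparable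

theorem setPair_self_lt (hF : ShiftSeparable F) (hij : i ≠ j) (z : ι → ℝ) {s t : ℝ} (h : s < t) :
    F (setPair z i s j s) < F (setPair z i t j t) :=
  (hF.strictMono (setPair_lt_left hij z s h)).trans (hF.strictMono (setPair_lt_right z t h))

theorem strictMono_setPair_self (hF : ShiftSeparable F) (hij : i ≠ j) (z : ι → ℝ) :
    StrictMono fun t => F (setPair z i t j t) :=
  fun _ _ h => hF.setPair_self_lt hij z h

variable [Fintype ι]

/-- Shifting `y` by the sup-distance dominates `x`, so monotonicity and shift equivariance alone
make `F` 1-Lipschitz. -/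
theorem le_add_dist (hF : ShiftSeparable F) (x y : ι → ℝ) : F x ≤ F y + dist x y := by
  rw [← hF.shift]
  refine hF.strictMono.monotone fun a => ?_
  have := (abs_le.1 ((Real.dist_eq _ _).symm.le.trans (dist_le_pi_dist x y a))).2
  linarith

theorem continuous (hF : ShiftSeparable F) : Continuous F := by
  refine (LipschitzWith.of_le_add (f := F) fun x y => hF.le_add_dist x y).continuous

theorem continuous_setPair (hF : ShiftSeparable F) (z : ι → ℝ) {u v : ℝ → ℝ}
    (hu : Continuous u) (hv : Continuous v) :
    Continuous fun t => F (setPair z i (u t) j (v t)) := by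
  have := hF.continuous
  unfold setPair
  fun_prop

/-- The intermediate value theorem between `min d 0` and `max d 0` supplies the value that `epsilon`
selects. -/
theorem pairMean_spec (hF : ShiftSeparable F) (d : ℝ) :
    F (setPair 0 i (pairMean F i j d) j (pairMean F i j d)) = F (setPair 0 i d j 0) := by
  refine Classical.epsilon_spec (p := fun t => F (setPair 0 i t j t) = F (setPair 0 i d j 0)) ?_
  have hc := hF.continuous_setPair (i := i) (j := j) 0 continuous_id continuous_id
  have key : ∀ x y x' y' : ℝ, x ≤ x' → y ≤ y' →
      F (setPair 0 i x j y) ≤ F (setPair 0 i x' j y') := fun x y x' y' h h' =>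
    hF.strictMono.monotone (update_le_update_iff.2 ⟨h', fun a _ => by
      unfold update; simp only [eq_rec_constant]; split_ifs <;> simp [h]⟩)
  have := mem_range_of_exists_le_of_exists_ge hc (c := F (setPair 0 i d j 0))
    ⟨min d 0, key _ _ _ _ (min_le_left _ _) (min_le_right _ _)⟩
    ⟨max d 0, key _ _ _ _ (le_max_left _ _) (le_max_right _ _)⟩
  exact this

/-- The defining indifference at base point `0` transfers to `z - y` by separability, then to `z` by
a shift by `y`. Every comparison within a pair thus reduces to comparing equal coordinates. -/
theorem apply_setPair (hF : ShiftSeparable F) (hij : i ≠ j) (z : ι → ℝ) (x y : ℝ) :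
    F (setPair z i x j y) =
      F (setPair z i (y + pairMean F i j (x - y)) j (y + pairMean F i j (x - y))) := by
  have h := hF.indep i j hij _ _ _ _ 0 (fun a => z a - y) (hF.pairMean_spec (x - y))
  have h' := congrArg (· + y) h
  simp only [← hF.shift, setPair_add, sub_add_cancel, zero_add] at h'
  rw [← h', add_comm]

theorem apply_setPair_lt_iff (hF : ShiftSeparable F) (hij : i ≠ j) (z : ι → ℝ) (x y x' y' : ℝ) :
    F (setPair z i x j y) < F (setPair z i x' j y') ↔
      y + pairMean F i j (x - y) < y' + pairMean F i j (x' - y') := by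
  rw [hF.apply_setPair hij z x y, hF.apply_setPair hij z x' y']
  exact (hF.strictMono_setPair_self hij z).lt_iff_lt

theorem apply_setPair_eq_iff (hF : ShiftSeparable F) (hij : i ≠ j) (z : ι → ℝ) (x y x' y' : ℝ) :
    F (setPair z i x j y) = F (setPair z i x' j y') ↔
      y + pairMean F i j (x - y) = y' + pairMean F i j (x' - y') := by
  rw [hF.apply_setPair hij z x y, hF.apply_setPair hij z x' y']
  exact (hF.strictMono_setPair_self hij z).injective.eq_iff

theorem pairMean_zero (hF : ShiftSeparable F) (hij : i ≠ j) : pairMean F i j 0 = 0 :=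
  (hF.strictMono_setPair_self hij 0).injective (hF.pairMean_spec 0)

theorem pairMean_swap (hF : ShiftSeparable F) (hij : i ≠ j) (d : ℝ) :
    pairMean F i j d = d + pairMean F j i (-d) := by
  have h1 := hF.apply_setPair hij 0 d 0
  have h2 := hF.apply_setPair hij.symm 0 0 d
  rw [setPair_comm hij, h2, setPair_comm hij.symm] at h1
  have := (hF.strictMono_setPair_self hij 0).injective h1
  simp only [zero_sub, sub_zero, zero_add] at this
  exact this.symm

theorem pairMean_strictMono (hF : ShiftSeparable F) (hij : i ≠ j) :
    StrictMono (pairMean F i j) := fun d d' h => by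
  simpa using (hF.apply_setPair_lt_iff hij 0 d 0 d' 0).1
    (hF.strictMono (setPair_lt_left hij 0 0 h))

/-- Exchanging the two coordinates turns monotonicity of `pairMean F j i` into an upper bound on the
growth of `pairMean F i j`. -/
theorem pairMean_sub_lt (hF : ShiftSeparable F) (hij : i ≠ j) {d d' : ℝ} (h : d < d') :
    pairMean F i j d' - pairMean F i j d < d' - d := by
  rw [hF.pairMean_swap hij d, hF.pairMean_swap hij d']
  have := hF.pairMean_strictMono hij.symm (neg_lt_neg h)
  linarith

theorem abs_pairMean_sub_le (hF : ShiftSeparable F) (hij : i ≠ j) (d d' : ℝ) :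
    |pairMean F i j d - pairMean F i j d'| ≤ |d - d'| := by
  rcases lt_trichotomy d d' with h | rfl | h
  · have h1 := hF.pairMean_sub_lt hij h
    have h2 := hF.pairMean_strictMono hij h
    rw [abs_of_neg (by linarith), abs_of_neg (by linarith)]; linarith
  · simp
  · have h1 := hF.pairMean_sub_lt hij h
    have h2 := hF.pairMean_strictMono hij h
    rw [abs_of_pos (by linarith), abs_of_pos (by linarith)]; linarith

theorem lipschitzWith_pairMean (hF : ShiftSeparable F) (hij : i ≠ j) :
    LipschitzWith 1 (pairMean F i j) :=
  LipschitzWith.of_dist_le_mul fun d d' => by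
    simpa [Real.dist_eq] using hF.abs_pairMean_sub_le hij d d'

theorem hasDerivAt_pairMean_swap (hF : ShiftSeparable F) (hij : i ≠ j) {d p : ℝ}
    (h : HasDerivAt (pairMean F i j) p d) : HasDerivAt (pairMean F j i) (1 - p) (-d) := by
  have e : pairMean F j i = fun t => t + pairMean F i j (-t) :=
    funext fun t => hF.pairMean_swap hij.symm t
  rw [e]
  have h' : HasDerivAt (pairMean F i j) p (-(-d)) := by rwa [neg_neg]
  exact ((hasDerivAt_id (-d)).add (h'.comp (-d) (hasDerivAt_neg (-d)))).congr_deriv (by ring)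

theorem pairMean_deriv_nonneg (hF : ShiftSeparable F) (hij : i ≠ j) {d p : ℝ}
    (h : HasDerivAt (pairMean F i j) p d) : 0 ≤ p :=
  h.deriv ▸ (hF.pairMean_strictMono hij).monotone.deriv_nonneg

theorem pairMean_deriv_le_one (hF : ShiftSeparable F) (hij : i ≠ j) {d p : ℝ}
    (h : HasDerivAt (pairMean F i j) p d) : p ≤ 1 := by
  have := hF.pairMean_deriv_nonneg hij.symm (hF.hasDerivAt_pairMean_swap hij h)
  linarith

end ShiftSeparable

end CFMM

/-! ### The chain rule for marginal rates. -/

namespace CFMM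

open Function Set Filter Topology MeasureTheory

variable {ι : Type*} [DecidableEq ι] {F : (ι → ℝ) → ℝ} {i j k : ι}

/-- If the increments `h - l h`, `κ`, `l h` are linked by the indifference relations of two
differentiable relative means, then `l` is differentiable at `0`. -/
theorem isLittleO_of_indifference {φ ψ l : ℝ → ℝ} {a b p q D : ℝ}
    (hφ : HasDerivAt φ p a) (hψ : HasDerivAt ψ q b) (hp0 : 0 ≤ p) (hp1 : p ≤ 1) (hq0 : 0 ≤ q)
    (hq1 : q ≤ 1) (hD : D = p * q + (1 - p) * (1 - q)) (hD0 : D ≠ 0)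
    (hl : ∀ h, |l h| ≤ |h|) (hs : ∀ h, |h - l h| ≤ |h|)
    (hκ : ∀ η > 0, ∀ᶠ h in 𝓝 0, ∃ κ, |κ| ≤ η ∧ φ (a + (h - l h + κ)) = φ a + κ ∧
      ψ (b + l h) = ψ (b + -κ) + l h) :
    (fun h => l h - h * (p * q / D)) =o[𝓝 0] fun h => h := by
  have hDnonneg : 0 ≤ D := by
    rw [hD]
    exact add_nonneg (mul_nonneg hp0 hq0) (mul_nonneg (sub_nonneg.2 hp1) (sub_nonneg.2 hq1))
  have hDpos : 0 < D := lt_of_le_of_ne hDnonneg hD0.symm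
  have hD1 : D ≤ 1 := by
    rw [hD]; nlinarith [mul_nonneg hp0 (sub_nonneg.2 hq1), mul_nonneg hq0 (sub_nonneg.2 hp1)]
  rw [Asymptotics.isLittleO_iff]
  intro c hc
  -- The first bound lets the error in `κ` be absorbed, giving `|κ| ≤ 4 / D * |h|`; the second makes
  -- the final error at most `c * |h|`.
  obtain ⟨ε, hε0, hε1, hε2⟩ : ∃ ε > 0, ε ≤ D / 4 ∧ 2 * ε * (1 + 4 / D) ≤ D * c := by
    refine ⟨min (D / 4) (D * c / (2 * (1 + 4 / D))), by positivity, min_le_left _ _, ?_⟩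
    have := min_le_right (D / 4) (D * c / (2 * (1 + 4 / D)))
    rw [le_div_iff₀ (by positivity)] at this
    linarith
  have h1 := hasDerivAt_iff_isLittleO_nhds_zero.1 hφ
  have h2 := hasDerivAt_iff_isLittleO_nhds_zero.1 hψ
  rw [Asymptotics.isLittleO_iff] at h1 h2
  obtain ⟨δ₁, hδ₁, h1⟩ := Metric.eventually_nhds_iff.1 (h1 hε0)
  obtain ⟨δ₂, hδ₂, h2⟩ := Metric.eventually_nhds_iff.1 (h2 hε0)
  obtain ⟨δ, hδ, hδa, hδb⟩ : ∃ δ > 0, 2 * δ < δ₁ ∧ 2 * δ < δ₂ :=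
    ⟨min δ₁ δ₂ / 3, by positivity, by linarith [min_le_left δ₁ δ₂], by
      linarith [min_le_right δ₁ δ₂, lt_min hδ₁ hδ₂]⟩
  filter_upwards [hκ δ hδ, Metric.ball_mem_nhds (0 : ℝ) hδ] with h ⟨κ, hκδ, e1, e2⟩ hh
  rw [Metric.mem_ball, Real.dist_0_eq_abs] at hh
  simp only [Real.dist_0_eq_abs, Real.norm_eq_abs, smul_eq_mul] at h1 h2 ⊢
  set L := l h
  have hL := hl h
  have hS := hs h
  have ht : |h - L + κ| ≤ |h| + |κ| := (abs_add_le _ _).trans (by linarith)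
  have E1 := h1 (y := h - L + κ) (by linarith)
  have E2 := h2 (y := L) (by linarith)
  have E3 := h2 (y := -κ) (by rw [abs_neg]; linarith)
  rw [abs_neg] at E3
  have E1' : |κ - (h - L + κ) * p| ≤ ε * (|h| + |κ|) := by
    rw [e1] at E1
    calc _ = |φ a + κ - φ a - (h - L + κ) * p| := by ring_nf
      _ ≤ _ := E1
      _ ≤ _ := by gcongr
  have E2' : |L - (L + κ) * q| ≤ ε * (|h| + |κ|) := by
    calc |L - (L + κ) * q| = |(ψ (b + L) - ψ b - L * q) - (ψ (b + -κ) - ψ b - -κ * q)| := by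
          rw [e2]; ring_nf
      _ ≤ _ := abs_sub _ _
      _ ≤ ε * |L| + ε * |κ| := add_le_add E2 E3
      _ ≤ _ := by rw [← mul_add]; gcongr
  set A := κ - (h - L + κ) * p
  set B := L - (L + κ) * q
  have bound : ∀ u v : ℝ, |u| ≤ 1 → |v| ≤ 1 → |u * A + v * B| ≤ 2 * (ε * (|h| + |κ|)) := by
    intro u v hu hv
    have hA : |u * A| ≤ ε * (|h| + |κ|) := by
      rw [abs_mul]
      exact (mul_le_of_le_one_left (abs_nonneg _) hu).trans E1'
    have hB : |v * B| ≤ ε * (|h| + |κ|) := by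
      rw [abs_mul]
      exact (mul_le_of_le_one_left (abs_nonneg _) hv).trans E2'
    exact (abs_add_le _ _).trans (by linarith)
  -- Cramer's rule for the linearised system `κ = (h - L + κ) * p`, `L = (L + κ) * q`, with
  -- residuals `A`, `B` and determinant `D`.
  have k1 : D * κ = p * (1 - q) * h + ((1 - q) * A + -p * B) := by
    simp only [A, B, hD]; ring
  have k2 : D * L - p * q * h = q * A + (1 - p) * B := by
    simp only [A, B, hD]; ring
  have hpq : 0 ≤ p * (1 - q) ∧ p * (1 - q) ≤ 1 :=
    ⟨mul_nonneg hp0 (by linarith), mul_le_one₀ hp1 (by linarith) (by linarith)⟩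
  have hκb : D * |κ| ≤ |h| + 2 * (ε * (|h| + |κ|)) := by
    rw [← abs_of_pos hDpos, ← abs_mul, k1]
    refine (abs_add_le _ _).trans (add_le_add ?_
      (bound _ _ (abs_le.2 ⟨by linarith, by linarith⟩) (abs_le.2 ⟨by linarith, by linarith⟩)))
    rw [abs_mul, abs_of_nonneg hpq.1]
    exact mul_le_of_le_one_left (abs_nonneg _) hpq.2
  have hκb' : |κ| ≤ 4 / D * |h| := by
    rw [div_mul_eq_mul_div, le_div_iff₀ hDpos]
    linarith [abs_nonneg h, mul_le_mul_of_nonneg_right hε1 (abs_nonneg h),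
      mul_le_mul_of_nonneg_right hε1 (abs_nonneg κ),
      mul_le_mul_of_nonneg_right hD1 (abs_nonneg h)]
  have fin : D * |L - h * (p * q / D)| ≤ D * (c * |h|) := by
    rw [← abs_of_pos hDpos, ← abs_mul, abs_of_pos hDpos]
    have : D * (L - h * (p * q / D)) = D * L - p * q * h := by field_simp
    rw [this, k2]
    calc |q * A + (1 - p) * B| ≤ 2 * (ε * (|h| + |κ|)) :=
          bound _ _ (abs_le.2 ⟨by linarith, hq1⟩) (abs_le.2 ⟨by linarith, by linarith⟩)
      _ ≤ 2 * (ε * (|h| + 4 / D * |h|)) := by gcongr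
      _ = 2 * ε * (1 + 4 / D) * |h| := by ring
      _ ≤ D * c * |h| := by gcongr
      _ = _ := by ring
  exact le_of_mul_le_mul_left fin hDpos

theorem setPair_update_swap (hij : i ≠ j) (z : ι → ℝ) (x y w : ℝ) :
    setPair (update z j y) i x k w = setPair (update z i x) j y k w := by
  unfold setPair; rw [update_comm hij]

theorem setPair_update_self (hjk : j ≠ k) (hik : i ≠ k) (z : ι → ℝ) (x y : ℝ) :
    setPair (update z i x) j y k (z k) = setPair z i x j y := by
  have : setPair z i x j y k = z k := by simp [setPair, hjk.symm, hik.symm]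
  rw [← this]
  exact update_eq_self k (setPair z i x j y)

namespace ShiftSeparable

variable [Fintype ι]

/-- Raising `i` by `h - l h` can be offset either by lowering `j` by some `κ` or by lowering `k` by
`l h`. The two offsets are thus indifferent to each other, which links the three relative means. The
intermediate value theorem gives a small `κ`. -/
theorem eventually_exists_compensation (hF : ShiftSeparable F) (hij : i ≠ j) (hjk : j ≠ k)
    (hik : i ≠ k) (a b : ℝ) {l : ℝ → ℝ}
    (hl : ∀ h, l h = pairMean F i k (a + b + h) - pairMean F i k (a + b)) {η : ℝ} (hη : 0 < η) :
    ∀ᶠ h in 𝓝 0, ∃ κ, |κ| ≤ η ∧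
      pairMean F i j (a + (h - l h + κ)) = pairMean F i j a + κ ∧
      pairMean F j k (b + l h) = pairMean F j k (b + -κ) + l h := by
  have hlc : Continuous l := by
    rw [funext hl]
    exact ((hF.lipschitzWith_pairMean hik).continuous.comp (by fun_prop)).sub continuous_const
  have hl0 : l 0 = 0 := by rw [hl]; simp
  have hc : ∀ y : ℝ, Continuous fun h => F (setPair 0 i (a + b + (h - l h)) j y) := fun y =>
    hF.continuous_setPair 0 (by fun_prop) continuous_const
  have hlo : F (setPair 0 i (a + b) j (b - η)) < F (setPair 0 i (a + b) j b) :=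
    hF.strictMono (setPair_lt_right _ _ (by linarith))
  have hhi : F (setPair 0 i (a + b) j b) < F (setPair 0 i (a + b) j (b + η)) :=
    hF.strictMono (setPair_lt_right _ _ (by linarith))
  have e1 := (hc (b - η)).continuousAt.eventually_lt (x₀ := 0) continuousAt_const
    (g := fun _ => F (setPair 0 i (a + b) j b)) (by simpa [hl0] using hlo)
  have e2 := (continuousAt_const (y := F (setPair 0 i (a + b) j b))).eventually_lt (x₀ := (0 : ℝ))
    (hc (b + η)).continuousAt (by simpa [hl0] using hhi)
  filter_upwards [e1, e2] with h h1 h2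
  have hcy : Continuous fun κ => F (setPair 0 i (a + b + (h - l h)) j (b - κ)) :=
    hF.continuous_setPair 0 continuous_const (by fun_prop)
  obtain ⟨κ, hκ, hκe⟩ := intermediate_value_Icc' (a := -η) (b := η) (by linarith)
    hcy.continuousOn (show F (setPair 0 i (a + b) j b) ∈ _ from ⟨h1.le, by simpa using h2.le⟩)
  refine ⟨κ, abs_le.2 hκ, ?_, ?_⟩
  · have := (hF.apply_setPair_eq_iff hij _ _ _ _ _).1 hκe
    rw [show a + b + (h - l h) - (b - κ) = a + (h - l h + κ) by ring,
      show a + b - b = a by ring] at this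
    linarith
  -- In coordinates `(i, j, k)`, both `(a + b + (h - l h), b, -l h)` and `(a + b + (h - l h), b - κ,
  -- 0)` are worth `(a + b, b, 0)`. They share coordinate `i`, leaving a relation for `(j, k)`.
  · have h13 : F (setPair (update 0 j b) i (a + b + (h - l h)) k (-(l h))) =
        F (setPair (update 0 j b) i (a + b) k 0) := by
      rw [hF.apply_setPair_eq_iff hik,
        show a + b + (h - l h) - -(l h) = a + b + h by ring, sub_zero]
      linarith [hl h]
    have := hκe
    simp only at this
    rw [← setPair_update_self hjk hik, ← setPair_update_self hjk hik, Pi.zero_apply,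
      ← setPair_update_swap hij 0 (a + b), ← h13, setPair_update_swap hij, hF.apply_setPair_eq_iff hjk, sub_zero,
      show b - -(l h) = b + l h by ring, show b - κ = b + -κ by ring] at this
    linarith

/-- Chain rule for marginal rates of substitution. -/
theorem hasDerivAt_pairMean_trans (hF : ShiftSeparable F) (hij : i ≠ j) (hjk : j ≠ k)
    (hik : i ≠ k) {a b p q : ℝ} (hp : HasDerivAt (pairMean F i j) p a)
    (hq : HasDerivAt (pairMean F j k) q b) (hD : p * q + (1 - p) * (1 - q) ≠ 0) :
    HasDerivAt (pairMean F i k) (p * q / (p * q + (1 - p) * (1 - q))) (a + b) := by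
  rw [hasDerivAt_iff_isLittleO_nhds_zero]
  have hb : ∀ h, |pairMean F i k (a + b + h) - pairMean F i k (a + b)| ≤ |h| := fun h => by
    simpa using hF.abs_pairMean_sub_le hik (a + b + h) (a + b)
  refine isLittleO_of_indifference (l := fun h => pairMean F i k (a + b + h) -
    pairMean F i k (a + b)) hp hq (hF.pairMean_deriv_nonneg hij hp)
    (hF.pairMean_deriv_le_one hij hp)
    (hF.pairMean_deriv_nonneg hjk hq) (hF.pairMean_deriv_le_one hjk hq) rfl hD hb (fun h => ?_)
    (fun η hη => hF.eventually_exists_compensation hij hjk hik a b (fun _ => rfl) hη)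
  have h1 := hF.abs_pairMean_sub_le hik.symm (-(a + b + h)) (-(a + b))
  rw [show h - (pairMean F i k (a + b + h) - pairMean F i k (a + b)) =
    -(pairMean F k i (-(a + b + h)) - pairMean F k i (-(a + b))) by
      rw [hF.pairMean_swap hik (a + b + h), hF.pairMean_swap hik (a + b)]; ring, abs_neg]
  exact h1.trans (le_of_eq (by rw [← abs_neg]; ring_nf))

end ShiftSeparable

end CFMM

/-! ### Regularity of relative means and the Cauchy equation for log-rates. -/

namespace CFMM

open Function Set Filter Topology MeasureTheory

/-- **Steinhaus theorem** for sums of two sets of positive measure. -/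
theorem exists_add_mem_nhds_of_volume_pos {A B : Set ℝ} (hA : MeasurableSet A)
    (hB : MeasurableSet B) (hA0 : volume A ≠ 0) (hB0 : volume B ≠ 0) :
    ∃ t, ∀ᶠ x in 𝓝 t, ∃ a ∈ A, ∃ b ∈ B, a + b = x := by
  obtain ⟨t, ht⟩ : ∃ t, volume (A ∩ (fun y => t - y) ⁻¹' B) ≠ 0 := by
    -- If every section were null, Fubini would give `volume B * volume A = 0`.
    by_contra! h
    have hS : MeasurableSet {z : ℝ × ℝ | z.2 ∈ A ∧ z.1 - z.2 ∈ B} :=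
      (measurable_snd hA).inter ((measurable_fst.sub measurable_snd) hB)
    have h0 : (volume.prod volume) {z : ℝ × ℝ | z.2 ∈ A ∧ z.1 - z.2 ∈ B} = 0 :=
      (Measure.measure_prod_null hS).2 (Eventually.of_forall h)
    rw [Measure.prod_apply_symm hS] at h0
    have hsec : ∀ y, volume ((fun x => (x, y)) ⁻¹' {z : ℝ × ℝ | z.2 ∈ A ∧ z.1 - z.2 ∈ B}) =
        A.indicator (fun _ => volume B) y := by
      intro y
      by_cases hy : y ∈ A
      · rw [indicator_of_mem hy]
        have : ((fun x => (x, y)) ⁻¹' {z : ℝ × ℝ | z.2 ∈ A ∧ z.1 - z.2 ∈ B}) =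
            (fun x => x + -y) ⁻¹' B := by
          ext x; simp [hy, sub_eq_add_neg]
        rw [this, measure_preimage_add_right]
      · simp [hy]
    simp_rw [hsec] at h0
    rw [lintegral_indicator hA, setLIntegral_const] at h0
    exact (mul_ne_zero hB0 hA0) h0
  have hE : MeasurableSet (A ∩ (fun y => t - y) ⁻¹' B) :=
    hA.inter ((measurable_const.sub measurable_id) hB)
  have hs := Measure.sub_mem_nhds_zero_of_addHaar_pos volume _ hE (pos_iff_ne_zero.2 ht)
  refine ⟨t, ?_⟩
  have hc : Tendsto (fun x => x - t) (𝓝 t) (𝓝 0) := by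
    simpa using (continuous_sub_right t).tendsto t
  filter_upwards [hc hs] with x hx
  obtain ⟨a, ha, b, hb, hab⟩ := hx
  exact ⟨a, ha.1, t - b, hb.2, by simp only at hab; linarith⟩

/-- A Lipschitz function is absolutely continuous, so a derivative vanishing almost everywhere would
make it constant on `[0, 1]`. -/
theorem volume_setOf_deriv_ne_zero {φ : ℝ → ℝ} (hm : StrictMono φ) (hl : LipschitzWith 1 φ) :
    volume {x | DifferentiableAt ℝ φ x ∧ deriv φ x ≠ 0} ≠ 0 := by
  intro h
  have hae : ∀ᵐ x, HasDerivAt φ 0 x := by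
    filter_upwards [hl.ae_differentiableAt_real, measure_eq_zero_iff_ae_notMem.1 h] with x h1 h2
    have : deriv φ x = 0 := by by_contra h3; exact h2 ⟨h1, h3⟩
    exact this ▸ h1.hasDerivAt
  obtain ⟨C, hC⟩ := (hl.lipschitzOnWith (s := uIcc 0 1)).absolutelyContinuousOnInterval
    |>.const_of_ae_hasDerivAt_zero (hae.mono fun x hx _ => hx)
  have := hm (zero_lt_one' ℝ)
  rw [hC 0 left_mem_uIcc, hC 1 right_mem_uIcc] at this
  exact lt_irrefl _ this

theorem measurableSet_setOf_deriv_ne_zero (φ : ℝ → ℝ) :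
    MeasurableSet {x | DifferentiableAt ℝ φ x ∧ deriv φ x ≠ 0} :=
  (measurableSet_of_differentiableAt ℝ φ).inter
    ((measurable_deriv φ) (measurableSet_singleton 0).compl)

theorem exists_eq_mul_of_measurable_of_add {g : ℝ → ℝ} (hg : Measurable g)
    (hadd : ∀ a b, g (a + b) = g a + g b) : ∃ γ, ∀ a, g a = γ * a := by
  have hc := Measure.AddMonoidHom.continuous_of_measurable (AddMonoidHom.mk' g hadd) hg
  refine ⟨g 1, fun a => ?_⟩
  have := map_real_smul (AddMonoidHom.mk' g hadd) hc a 1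
  simpa [mul_comm] using this

variable {ι : Type*} [DecidableEq ι] {F : (ι → ℝ) → ℝ} {i j k : ι}

theorem exists_third [Fintype ι] (h : 2 < Fintype.card ι) (i j : ι) : ∃ k, i ≠ k ∧ j ≠ k := by
  by_contra! hk
  have : (Finset.univ : Finset ι) ⊆ {i, j} := fun k _ => by
    have := hk k
    simp only [Finset.mem_insert, Finset.mem_singleton]
    tauto
  have h1 := (Finset.card_le_card this).trans Finset.card_le_two
  rw [Finset.card_univ] at h1
  omega

namespace ShiftSeparable

variable [Fintype ι]

/-- A zero rate propagates along `i → j → k → j` to every `a - y - z` where `y` and `z` range over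
sets of positive measure. By Steinhaus these points fill an interval, on which `pairMean F i j`
would be constant. -/
theorem not_hasDerivAt_pairMean_zero (hF : ShiftSeparable F) (hij : i ≠ j) (hjk : j ≠ k)
    (hik : i ≠ k) (a : ℝ) : ¬HasDerivAt (pairMean F i j) 0 a := by
  intro h0
  obtain ⟨t, ht⟩ := exists_add_mem_nhds_of_volume_pos
    (measurableSet_setOf_deriv_ne_zero (pairMean F k j))
    (measurableSet_setOf_deriv_ne_zero (pairMean F j k))
    (volume_setOf_deriv_ne_zero (hF.pairMean_strictMono hjk.symm)
      (hF.lipschitzWith_pairMean hjk.symm))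
    (volume_setOf_deriv_ne_zero (hF.pairMean_strictMono hjk) (hF.lipschitzWith_pairMean hjk))
  have key : ∀ᶠ x in 𝓝 t, HasDerivAt (pairMean F i j) 0 (a - x) := by
    filter_upwards [ht] with x ⟨y, ⟨hy, hy0⟩, z, ⟨hz, hz0⟩, hx⟩
    have h1 := hF.hasDerivAt_pairMean_trans hij hjk hik h0
      (hF.hasDerivAt_pairMean_swap hjk.symm hy.hasDerivAt) (by simpa using hy0)
    rw [zero_mul, zero_div] at h1
    have h2 := hF.hasDerivAt_pairMean_trans hik hjk.symm hij h1
      (hF.hasDerivAt_pairMean_swap hjk hz.hasDerivAt) (by simpa using hz0)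
    rw [zero_mul, zero_div] at h2
    rwa [show a - x = a + -y + -z by rw [← hx]; ring]
  obtain ⟨δ, hδ, hb⟩ := Metric.eventually_nhds_iff.1 key
  have hd : ∀ x ∈ Ioo (a - t) (a - t + δ), HasDerivAt (pairMean F i j) 0 x := fun x hx => by
    have := hb (y := a - x) (by rw [Real.dist_eq, abs_lt]; constructor <;> linarith [hx.1, hx.2])
    rwa [sub_sub_cancel] at this
  obtain ⟨c, -, hc⟩ := exists_hasDerivAt_eq_slope (pairMean F i j) (fun _ => 0)
    (show a - t < a - t + δ by linarith)
    (hF.lipschitzWith_pairMean hij).continuous.continuousOn hd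
  have hlt := hF.pairMean_strictMono hij (show a - t < a - t + δ by linarith)
  have : 0 < (pairMean F i j (a - t + δ) - pairMean F i j (a - t)) / (a - t + δ - (a - t)) :=
    div_pos (by linarith) (by linarith)
  linarith

theorem hasDerivAt_pairMean_mem_Ioo (hF : ShiftSeparable F) (hc : 2 < Fintype.card ι)
    (hij : i ≠ j) {d p : ℝ} (h : HasDerivAt (pairMean F i j) p d) : 0 < p ∧ p < 1 := by
  obtain ⟨k, hik, hjk⟩ := exists_third hc i j
  constructor
  · refine lt_of_le_of_ne (hF.pairMean_deriv_nonneg hij h) ?_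
    rintro rfl
    exact hF.not_hasDerivAt_pairMean_zero hij hjk hik d h
  · refine lt_of_le_of_ne (hF.pairMean_deriv_le_one hij h) ?_
    rintro rfl
    have := hF.hasDerivAt_pairMean_swap hij h
    rw [sub_self] at this
    exact hF.not_hasDerivAt_pairMean_zero hij.symm hik hjk _ this

/-- For almost every `a`, the means of `(i, j)` at `a` and of `(j, k)` at `c - a` are both
differentiable; the chain rule then applies at their sum `c`. -/
theorem differentiable_pairMean (hF : ShiftSeparable F) (hc : 2 < Fintype.card ι) (hik : i ≠ k) :
    Differentiable ℝ (pairMean F i k) := by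
  intro c
  obtain ⟨j, hij, hkj⟩ := exists_third hc i k
  have h1 := (hF.lipschitzWith_pairMean hij).ae_differentiableAt_real
  have h2 := (Measure.measurePreserving_sub_left volume c).quasiMeasurePreserving.ae
    (hF.lipschitzWith_pairMean hkj.symm).ae_differentiableAt_real
  obtain ⟨a, ha, hb⟩ := (h1.and h2).exists
  have p := hF.hasDerivAt_pairMean_mem_Ioo hc hij ha.hasDerivAt
  have q := hF.hasDerivAt_pairMean_mem_Ioo hc hkj.symm hb.hasDerivAt
  have := hF.hasDerivAt_pairMean_trans hij hkj.symm hik ha.hasDerivAt hb.hasDerivAt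
    (add_pos (mul_pos p.1 q.1) (mul_pos (sub_pos.2 p.2) (sub_pos.2 q.2))).ne'
  rw [add_sub_cancel] at this
  exact this.differentiableAt

/-- Logarithms of marginal rates of substitution add up along triples of coordinates. -/
theorem log_rate_trans (hF : ShiftSeparable F) (hc : 2 < Fintype.card ι) (hij : i ≠ j)
    (hjk : j ≠ k) (hik : i ≠ k) (a b : ℝ) :
    Real.log (deriv (pairMean F i k) (a + b) / (1 - deriv (pairMean F i k) (a + b))) =
      Real.log (deriv (pairMean F i j) a / (1 - deriv (pairMean F i j) a)) +
      Real.log (deriv (pairMean F j k) b / (1 - deriv (pairMean F j k) b)) := by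
  have hp := (hF.differentiable_pairMean hc hij a).hasDerivAt
  have hq := (hF.differentiable_pairMean hc hjk b).hasDerivAt
  have p := hF.hasDerivAt_pairMean_mem_Ioo hc hij hp
  have q := hF.hasDerivAt_pairMean_mem_Ioo hc hjk hq
  set P := deriv (pairMean F i j) a
  set Q := deriv (pairMean F j k) b
  have p' := sub_pos.2 p.2
  have q' := sub_pos.2 q.2
  have hD : 0 < P * Q + (1 - P) * (1 - Q) := add_pos (mul_pos p.1 q.1) (mul_pos p' q')
  rw [(hF.hasDerivAt_pairMean_trans hij hjk hik hp hq hD.ne').deriv,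
    ← Real.log_mul (div_pos p.1 p').ne' (div_pos q.1 q').ne']
  congr 1
  have e : 1 - P * Q / (P * Q + (1 - P) * (1 - Q)) =
      (1 - P) * (1 - Q) / (P * Q + (1 - P) * (1 - Q)) := by
    field_simp; ring
  rw [e, div_div_div_cancel_right₀ hD.ne', mul_div_mul_comm]

theorem log_rate_swap (hF : ShiftSeparable F) (hc : 2 < Fintype.card ι) (hij : i ≠ j) (a : ℝ) :
    Real.log (deriv (pairMean F j i) (-a) / (1 - deriv (pairMean F j i) (-a))) =
      -Real.log (deriv (pairMean F i j) a / (1 - deriv (pairMean F i j) a)) := by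
  have hp := (hF.differentiable_pairMean hc hij a).hasDerivAt
  rw [(hF.hasDerivAt_pairMean_swap hij hp).deriv, ← Real.log_inv, inv_div, sub_sub_cancel]

end ShiftSeparable

/-- Log-rates that are additive along triples of distinct indices are affine with common slope and
constant terms of potential type. -/
theorem exists_slope_potential [Fintype ι] (hc : 2 < Fintype.card ι) (R : ι → ι → ℝ → ℝ)
    (hm : ∀ i j, Measurable (R i j))
    (htrans : ∀ i j k, i ≠ j → j ≠ k → i ≠ k → ∀ a b, R i k (a + b) = R i j a + R j k b)
    (hswap : ∀ i j, i ≠ j → ∀ a, R j i (-a) = -R i j a) :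
    ∃ (γ : ℝ) (A : ι → ℝ), ∀ i j, i ≠ j → ∀ a, R i j a = A i - A j + γ * a := by
  have hlin : ∀ i j, i ≠ j → ∃ γ, ∀ a, R i j a = R i j 0 + γ * a := by
    intro i j hij
    obtain ⟨k, hik, hjk⟩ := exists_third hc i j
    -- Splitting `a + b` and `b` across `i → j → k` in two ways each eliminates `R i k` and `R j k`.
    obtain ⟨γ, hγ⟩ := exists_eq_mul_of_measurable_of_add (g := fun a => R i j a - R i j 0)
      ((hm i j).sub measurable_const) (fun a b => by
        have h1 := htrans i j k hij hjk hik (a + b) 0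
        have h2 := htrans i j k hij hjk hik a b
        have h3 := htrans i j k hij hjk hik 0 b
        have h4 := htrans i j k hij hjk hik b 0
        rw [add_zero] at h1 h4
        rw [zero_add] at h3
        linarith)
    exact ⟨γ, fun a => by linarith [hγ a]⟩
  choose! g hg using hlin
  have g_swap : ∀ i j, i ≠ j → g j i = g i j := fun i j hij => by
    have h1 := hswap i j hij 1
    have h0 := hswap i j hij 0
    rw [neg_zero] at h0
    rw [hg i j hij 1, hg j i hij.symm] at h1
    linarith
  have g_left : ∀ i j k, i ≠ j → j ≠ k → i ≠ k → g i k = g i j := fun i j k hij hjk hik => by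
    have h1 := htrans i j k hij hjk hik 1 0
    have h0 := htrans i j k hij hjk hik 0 0
    rw [add_zero] at h1 h0
    rw [hg i k hik 1, hg i j hij 1] at h1
    linarith
  obtain ⟨o⟩ : Nonempty ι := Fintype.card_pos_iff.1 (by omega)
  obtain ⟨o', ho', -⟩ := exists_third hc o o
  have g_o : ∀ j, o ≠ j → g o j = g o o' := fun j hj => by
    by_cases h : j = o'
    · rw [h]
    · exact g_left o o' j ho' (Ne.symm h) hj
  have g_const : ∀ i j, i ≠ j → g i j = g o o' := fun i j hij => by
    by_cases hi : i = o
    · subst hi; exact g_o j hij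
    by_cases hj : j = o
    · subst hj; rw [← g_swap i j hij, g_o i hij.symm]
    rw [g_left i o j hi (Ne.symm hj) hij, ← g_swap i o hi, g_o i (Ne.symm hi)]
  -- The potential is normalised to vanish at the base index `o`.
  refine ⟨g o o', fun i => if i = o then 0 else R i o 0, fun i j hij a => ?_⟩
  rw [hg i j hij, g_const i j hij]
  congr 1
  by_cases hi : i = o
  · subst hi
    have := hswap i j hij 0
    rw [neg_zero] at this
    simp [hij.symm, this]
  by_cases hj : j = o
  · subst hj; simp [hi]
  have := htrans i j o hij hj hi 0 0
  rw [add_zero] at this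
  simp [hi, hj, this]

theorem ShiftSeparable.exists_hasDerivAt_pairMean [Fintype ι] (hF : ShiftSeparable F)
    (hc : 2 < Fintype.card ι) :
    ∃ (γ : ℝ) (α : ι → ℝ), (∀ i, 0 < α i) ∧ ∑ i, α i = 1 ∧ ∀ i j, i ≠ j → ∀ d,
      HasDerivAt (pairMean F i j)
        (α i * Real.exp (γ * d) / (α i * Real.exp (γ * d) + α j)) d := by
  obtain ⟨γ, A, hA⟩ := exists_slope_potential hc
    (fun i j a => Real.log (deriv (pairMean F i j) a / (1 - deriv (pairMean F i j) a)))
    (fun i j => Real.measurable_log.comp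
      ((measurable_deriv _).div (measurable_const.sub (measurable_deriv _))))
    (fun i j k hij hjk hik a b => hF.log_rate_trans hc hij hjk hik a b)
    (fun i j hij a => hF.log_rate_swap hc hij a)
  have : Nonempty ι := Fintype.card_pos_iff.1 (by omega)
  have hS : 0 < ∑ i, Real.exp (A i) := Finset.sum_pos (fun i _ => Real.exp_pos _)
    Finset.univ_nonempty
  -- Only ratios of the weights enter the odds `exp (A i - A j + γ * d)`, so they may be scaled to
  -- sum to 1.
  refine ⟨γ, fun i => Real.exp (A i) / ∑ i, Real.exp (A i), fun i => by positivity, ?_, ?_⟩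
  · rw [← Finset.sum_div, div_self hS.ne']
  intro i j hij d
  have hp := (hF.differentiable_pairMean hc hij d).hasDerivAt
  have p := hF.hasDerivAt_pairMean_mem_Ioo hc hij hp
  have p' := sub_pos.2 p.2
  refine hp.congr_deriv ?_
  have h := hA i j hij d
  apply_fun Real.exp at h
  rw [Real.exp_log (div_pos p.1 p'), Real.exp_add, Real.exp_sub] at h
  set P := deriv (pairMean F i j) d
  have e1 := Real.exp_pos (A i)
  have e2 := Real.exp_pos (A j)
  have e3 := Real.exp_pos (γ * d)
  have : P * Real.exp (A j) = Real.exp (A i) * Real.exp (γ * d) * (1 - P) := by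
    field_simp at h
    linarith
  set S := ∑ i, Real.exp (A i)
  rw [div_mul_eq_mul_div, ← add_div, div_div_div_cancel_right₀ hS.ne',
    eq_div_iff (by positivity)]
  linarith

end CFMM

/-! ### Integration to an additive utility and reduction to constant points. -/

namespace CFMM

open Function Set Filter Topology

/-- The utility function `y ^ γ / γ`, or `log y` for `γ = 0`. -/
noncomputable def crra (γ y : ℝ) : ℝ := if γ = 0 then Real.log y else y ^ γ / γ

theorem crra_exp_zero (x : ℝ) : crra 0 (Real.exp x) = x := by simp [crra]

theorem crra_exp {γ : ℝ} (hγ : γ ≠ 0) (x : ℝ) : crra γ (Real.exp x) = Real.exp (γ * x) / γ := by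
  rw [crra, if_neg hγ, ← Real.exp_mul, mul_comm]

theorem hasDerivAt_crra_exp (γ x : ℝ) :
    HasDerivAt (fun x => crra γ (Real.exp x)) (Real.exp (γ * x)) x := by
  by_cases hγ : γ = 0
  · subst hγ
    simp only [crra_exp_zero, zero_mul, Real.exp_zero]
    exact hasDerivAt_id x
  · simp only [crra_exp hγ]
    refine ((((hasDerivAt_id x).const_mul γ).exp).div_const γ).congr_deriv ?_
    simp only [id, mul_one]
    field_simp

theorem strictMono_crra_exp (γ : ℝ) : StrictMono fun x => crra γ (Real.exp x) :=
  strictMono_of_deriv_pos fun x => by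
    rw [(hasDerivAt_crra_exp γ x).deriv]; exact Real.exp_pos _

theorem continuous_crra_exp (γ : ℝ) : Continuous fun x => crra γ (Real.exp x) :=
  continuous_iff_continuousAt.2 fun x => (hasDerivAt_crra_exp γ x).continuousAt

theorem crra_strictMonoOn (γ : ℝ) : StrictMonoOn (crra γ) (Ioi 0) := fun x hx y hy h => by
  have := strictMono_crra_exp γ (Real.log_lt_log hx h)
  simpa only [Real.exp_log hx, Real.exp_log hy] using this

variable {ι : Type*} [DecidableEq ι] {F : (ι → ℝ) → ℝ} {i j : ι}

theorem sum_update_add [Fintype ι] (g : ι → ℝ → ℝ) (x : ι → ℝ) (i : ι) (u : ℝ) :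
    ∑ a, g a (update x i u a) + g i (x i) = ∑ a, g a (x a) + g i u := by
  rw [← Finset.add_sum_erase _ _ (Finset.mem_univ i),
    ← Finset.add_sum_erase (a := i) _ (fun a => g a (x a)) (Finset.mem_univ i),
    Finset.sum_congr rfl fun a ha => by rw [update_of_ne (Finset.ne_of_mem_erase ha)],
    update_self]
  ring

theorem sum_setPair_add [Fintype ι] (hij : i ≠ j) (g : ι → ℝ → ℝ) (x : ι → ℝ) (u v : ℝ) :
    ∑ a, g a (setPair x i u j v a) + (g i (x i) + g j (x j)) =
      ∑ a, g a (x a) + (g i u + g j v) := by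
  have h1 := sum_update_add g x i u
  have h2 := sum_update_add g (update x i u) j v
  rw [update_of_ne hij.symm] at h2
  simp only [setPair]
  linarith

/-- The relative means are those of the utility `∑ a, α a * crra γ (exp (x a))`. -/
theorem sum_crra_eq_of_hasDerivAt {φ : ℝ → ℝ} {α β γ : ℝ} (hα : 0 < α) (hβ : 0 < β)
    (h0 : φ 0 = 0)
    (hφ : ∀ d, HasDerivAt φ (α * Real.exp (γ * d) / (α * Real.exp (γ * d) + β)) d) (x y : ℝ) :
    α * crra γ (Real.exp x) + β * crra γ (Real.exp y) =
      (α + β) * crra γ (Real.exp (y + φ (x - y))) := by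
  by_cases hγ : γ = 0
  · subst hγ
    have hd : ∀ d, HasDerivAt (fun d => (α + β) * φ d - α * d) 0 d := fun d => by
      refine (((hφ d).const_mul (α + β)).sub ((hasDerivAt_id d).const_mul α)).congr_deriv ?_
      simp only [zero_mul, Real.exp_zero, mul_one]
      field_simp
      ring
    have := is_const_of_deriv_eq_zero (fun d => (hd d).differentiableAt) (fun d => (hd d).deriv)
      (x - y) 0
    simp only [h0, mul_zero, sub_zero] at this
    simp only [crra_exp_zero]
    linarith
  · have hE : ∀ d, 0 < α * Real.exp (γ * d) + β := fun d => by positivity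
    -- A first integral of the differential equation for `φ`; its value at `0` is `1 / (α + β)`.
    have hd : ∀ d, HasDerivAt (fun d => Real.exp (γ * φ d) / (α * Real.exp (γ * d) + β)) 0 d := by
      intro d
      refine ((((hφ d).const_mul γ).exp).div
        (((((hasDerivAt_id d).const_mul γ).exp).const_mul α).add_const β) (hE d).ne').congr_deriv ?_
      have := (hE d).ne'
      simp only [id]
      field_simp
      ring
    have := is_const_of_deriv_eq_zero (fun d => (hd d).differentiableAt) (fun d => (hd d).deriv)
      (x - y) 0
    simp only [h0, mul_zero, Real.exp_zero, mul_one] at this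
    rw [div_eq_div_iff (hE _).ne' (by positivity), one_mul] at this
    simp only [crra_exp hγ]
    have e1 : Real.exp (γ * (y + φ (x - y))) = Real.exp (γ * y) * Real.exp (γ * φ (x - y)) := by
      rw [← Real.exp_add]; ring_nf
    have e2 : Real.exp (γ * x) = Real.exp (γ * y) * Real.exp (γ * (x - y)) := by
      rw [← Real.exp_add]; ring_nf
    rw [e1, e2]
    field_simp
    linarith

/-- A point that is not constant but has the same weighted mean as the constant `t` has two
coordinates whose joint mean can be kept while one of them is moved to `t`. -/
theorem exists_move {ι : Type*} [Fintype ι] {α : ι → ℝ} (hα : ∀ i, 0 < α i) {U : ℝ → ℝ}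
    (hU : StrictMono U) (hUc : Continuous U) {x : ι → ℝ} {t : ℝ}
    (hs : ∑ a, α a * U (x a) = ∑ a, α a * U t) (hx : ∃ a, x a ≠ t) :
    ∃ i j, i ≠ j ∧ x j ≠ t ∧ x i ≠ t ∧
      ∃ s, α i * U s + α j * U t = α i * U (x i) + α j * U (x j) := by
  have h0 : ∑ a, α a * (U (x a) - U t) = 0 := by
    simp_rw [mul_sub, Finset.sum_sub_distrib, hs, sub_self]
  have hne : ∃ a ∈ Finset.univ, α a * (U (x a) - U t) ≠ 0 := by
    obtain ⟨a, ha⟩ := hx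
    exact ⟨a, Finset.mem_univ a, mul_ne_zero (hα a).ne' (sub_ne_zero.2 (hU.injective.ne ha))⟩
  obtain ⟨j, -, hj⟩ := Finset.exists_pos_of_sum_zero_of_exists_nonzero _ h0 hne
  obtain ⟨i, -, hi⟩ := Finset.exists_pos_of_sum_zero_of_exists_nonzero
    (s := Finset.univ) (fun a => -(α a * (U (x a) - U t)))
    (by rw [Finset.sum_neg_distrib, h0, neg_zero])
    (by obtain ⟨a, h, h'⟩ := hne; exact ⟨a, h, neg_ne_zero.2 h'⟩)
  have hj' : t < x j := hU.lt_iff_lt.1 (sub_pos.1 (pos_of_mul_pos_right hj (hα j).le))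
  have hi' : x i < t := by
    rw [← mul_neg, neg_sub] at hi
    exact hU.lt_iff_lt.1 (sub_pos.1 (pos_of_mul_pos_right hi (hα i).le))
  have hij : i ≠ j := by rintro rfl; exact lt_asymm hj' hi'
  have ui := mul_lt_mul_of_pos_left (hU hi') (hα i)
  have uj := mul_lt_mul_of_pos_left (hU hj') (hα j)
  -- Here `x i < t < x j`. If the pair is worth at most `(t, t)`, `j` is set to `t` and `i`
  -- compensates; otherwise the roles are exchanged. The compensating value lies between known
  -- bounds.
  rcases le_total (α i * U (x i) + α j * U (x j)) (α i * U t + α j * U t) with h | h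
  · refine ⟨i, j, hij, hj'.ne', hi'.ne, ?_⟩
    exact mem_range_of_exists_le_of_exists_ge (f := fun s => α i * U s + α j * U t)
      (by fun_prop) ⟨x i, by linarith⟩ ⟨t, h⟩
  · refine ⟨j, i, hij.symm, hi'.ne, hj'.ne', ?_⟩
    exact mem_range_of_exists_le_of_exists_ge (f := fun s => α j * U s + α i * U t)
      (by fun_prop) ⟨t, by linarith⟩ ⟨x j, by linarith⟩

/-- Induction on the number of coordinates different from `t`: each move sets `j` to `t` and alters
only a coordinate `i` already counted. -/
theorem apply_eq_apply_const_of_sum_eq [Fintype ι] {α : ι → ℝ} (hα : ∀ i, 0 < α i) {U : ℝ → ℝ}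
    (hU : StrictMono U) (hUc : Continuous U)
    (hF : ∀ i j, i ≠ j → ∀ z x y x' y', α i * U x + α j * U y = α i * U x' + α j * U y' →
      F (setPair z i x j y) = F (setPair z i x' j y'))
    (t : ℝ) (x : ι → ℝ) (hs : ∑ a, α a * U (x a) = ∑ a, α a * U t) : F x = F fun _ => t := by
  induction hn : (Finset.univ.filter fun a => x a ≠ t).card using Nat.strong_induction_on
    generalizing x with
  | _ n ih =>
  by_cases hx : ∃ a, x a ≠ t
  · obtain ⟨i, j, hij, hj, hi, s, hsum⟩ := exists_move hα hU hUc hs hx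
    have h1 : F x = F (setPair x i s j t) := by
      conv_lhs => rw [← setPair_self (i := i) (j := j) x]
      exact hF i j hij _ _ _ _ _ hsum.symm
    rw [h1]
    refine ih _ ?_ _ ?_ rfl
    · rw [← hn]
      refine Finset.card_lt_card (Finset.ssubset_iff_of_subset (fun a ha => ?_) |>.2
        ⟨j, by simp [hj], fun hm => (Finset.mem_filter.1 hm).2 (by simp [setPair])⟩)
      simp only [Finset.mem_filter, Finset.mem_univ, true_and] at ha ⊢
      by_cases haj : a = j
      · rwa [haj]
      by_cases hai : a = i
      · rwa [hai]
      simpa [setPair, haj, hai] using ha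
    · have := sum_setPair_add hij (fun a y => α a * U y) x s t
      linarith
  · push Not at hx
    rw [funext hx]

theorem ShiftSeparable.exists_crra [Fintype ι] (hF : ShiftSeparable F)
    (hc : 2 < Fintype.card ι) :
    ∃ (γ : ℝ) (α : ι → ℝ), (∀ i, 0 < α i) ∧ ∑ i, α i = 1 ∧ ∀ x t,
      ∑ a, α a * crra γ (Real.exp (x a)) = crra γ (Real.exp t) → F x = F 0 + t := by
  obtain ⟨γ, α, hα, hα1, h⟩ := hF.exists_hasDerivAt_pairMean hc
  refine ⟨γ, α, hα, hα1, fun x t hxt => ?_⟩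
  have := hF.shift 0 t
  simp only [Pi.zero_apply, zero_add] at this
  rw [← this]
  refine apply_eq_apply_const_of_sum_eq hα (strictMono_crra_exp γ) (continuous_crra_exp γ)
    (fun i j hij z x y x' y' e => ?_) t x (by rw [hxt, ← Finset.sum_mul, hα1, one_mul])
  rw [hF.apply_setPair_eq_iff hij]
  have key := sum_crra_eq_of_hasDerivAt (hα i) (hα j) (hF.pairMean_zero hij) (h i j hij)
  rw [key, key] at e
  exact (strictMono_crra_exp γ).injective
    (mul_left_cancel₀ (add_pos (hα i) (hα j)).ne' e)

end CFMM

/-! ### From log coordinates back to inventories, and the converse directions. -/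

namespace CFMM

open Function Set Filter Topology

variable {ι : Type*} {f : Inventory ι → ℝ}

/-! ### Trading functions that are homogeneous in liquidity -/

/-- The positive inventory with log-quantities `x`. -/
noncomputable def expInventory (x : ι → ℝ) : Inventory ι := fun a => (Real.exp (x a)).toNNReal

theorem coe_expInventory (x : ι → ℝ) (a : ι) : (expInventory x a : ℝ) = Real.exp (x a) :=
  Real.coe_toNNReal _ (Real.exp_pos _).le

theorem allPos_expInventory (x : ι → ℝ) : AllPos (expInventory x) := fun _ =>
  Real.toNNReal_pos.2 (Real.exp_pos _)

theorem expInventory_log {I : Inventory ι} (hI : AllPos I) :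
    expInventory (fun a => Real.log (I a)) = I := by
  funext a
  rw [expInventory, Real.exp_log (NNReal.coe_pos.2 (hI a)), Real.toNNReal_coe]

theorem expInventory_strictMono : StrictMono (expInventory (ι := ι)) := by
  refine Monotone.strictMono_of_injective (fun x y h a => ?_) fun x y h => ?_
  · exact Real.toNNReal_le_toNNReal (Real.exp_le_exp.2 (h a))
  · funext a
    have := congrArg (fun I : Inventory ι => (I a : ℝ)) h
    simp only [coe_expInventory] at this
    exact Real.exp_injective this

theorem expInventory_add (x : ι → ℝ) (t : ℝ) :
    expInventory (fun a => x a + t) = (Real.exp t).toNNReal • expInventory x := by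
  funext a
  apply NNReal.coe_injective
  rw [coe_expInventory, Pi.smul_apply, smul_eq_mul, NNReal.coe_mul, coe_expInventory,
    Real.coe_toNNReal _ (Real.exp_pos _).le, Real.exp_add, mul_comm]

theorem mix_expInventory [DecidableEq ι] (i j : ι) (u v x' y' : ℝ) (w z : ι → ℝ) :
    mix {i, j} (expInventory (setPair w i u j v)) (expInventory (setPair z i x' j y')) =
      expInventory (setPair z i u j v) := by
  funext a
  by_cases haj : a = j
  · subst haj; simp [mix, expInventory, setPair]
  by_cases hai : a = i
  · subst hai; simp [mix, expInventory, setPair, haj]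
  simp [mix, expInventory, setPair, haj, hai]

theorem AllPos.mix (B : Set ι) {I J : Inventory ι} (hI : AllPos I) (hJ : AllPos J) : AllPos (mix B I J) := fun a => by
  unfold CFMM.mix
  split_ifs
  exacts [hI a, hJ a]

theorem AllPos.convexComb {I J : Inventory ι} {a b : ℝ≥0}
    (hab : a + b = 1) (hI : AllPos I) (hJ : AllPos J) :
    AllPos (a • I + b • J) := fun i => by
  simp only [Pi.add_apply, Pi.smul_apply, smul_eq_mul]
  rcases eq_or_ne a 0 with rfl | ha
  · rw [zero_add] at hab
    simpa [hab] using hJ i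
  · exact add_pos_of_pos_of_nonneg (mul_pos (pos_iff_ne_zero.2 ha) (hI i)) zero_le

/-- Positive inventories approximating `I`. -/
noncomputable def approx (I : Inventory ι) (n : ℕ) : Inventory ι :=
  fun a => I a + 1 / ((n : ℝ≥0) + 1)

theorem allPos_approx (I : Inventory ι) (n : ℕ) : AllPos (approx I n) := fun _ => by
  unfold approx; positivity

theorem tendsto_approx (I : Inventory ι) : Tendsto (approx I) atTop (𝓝 I) := by
  refine tendsto_pi_nhds.2 fun a => ?_
  have h : Tendsto (fun n : ℕ => 1 / ((n : ℝ≥0) + 1)) atTop (𝓝 0) := by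
    rw [← NNReal.tendsto_coe]
    simpa using tendsto_one_div_add_atTop_nhds_zero_nat (𝕜 := ℝ)
  simpa [approx] using (tendsto_const_nhds (x := I a)).add h

theorem HomogeneityInLiquidity.map_zero (hh : HomogeneityInLiquidity f) : f 0 = 0 := by
  have := hh 0 2 (by norm_num)
  rw [smul_zero, NNReal.coe_ofNat] at this
  linarith

namespace IsTradingFunction

theorem pos [Nonempty ι] (hf : IsTradingFunction f) (hh : HomogeneityInLiquidity f)
    {I : Inventory ι} (hI : AllPos I) : 0 < f I := by
  have h2 : AllPos ((2 : ℝ≥0) • I) := fun a => by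
    have := hI a
    simp only [Pi.smul_apply, smul_eq_mul]
    positivity
  have hlt : I < (2 : ℝ≥0) • I := by
    have key : ∀ a, I a < ((2 : ℝ≥0) • I) a := fun a => by
      rw [Pi.smul_apply, smul_eq_mul, two_mul]
      exact lt_add_of_pos_right _ (hI a)
    exact Pi.lt_def.2 ⟨fun a => (key a).le, Classical.arbitrary ι, key _⟩
  have := hf.strictMono hI h2 hlt
  rw [hh I 2 (by norm_num), NNReal.coe_ofNat] at this
  linarith

theorem nonneg [Nonempty ι] (hf : IsTradingFunction f) (hh : HomogeneityInLiquidity f)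
    (I : Inventory ι) : 0 ≤ f I := by
  have := (hf.isClosed_upper 0).mem_of_tendsto (tendsto_approx I) (Eventually.of_forall fun n => by
    rw [mem_ofPred_eq, hh.map_zero]
    exact (hf.pos hh (allPos_approx I n)).le)
  rwa [mem_ofPred_eq, hh.map_zero] at this

theorem exists_eq [Nonempty ι] (hf : IsTradingFunction f) (hh : HomogeneityInLiquidity f)
    {v : ℝ} (hv : 0 < v) : ∃ I, AllPos I ∧ f I = v := by
  have h1 := hf.pos hh (I := fun _ => 1) fun _ => one_pos
  have hq : 0 < v / f (fun _ => 1) := div_pos hv h1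
  refine ⟨(v / f (fun _ => 1)).toNNReal • fun _ => 1, fun a => ?_, ?_⟩
  · simpa using hq
  · rw [hh _ _ (Real.toNNReal_pos.2 hq), Real.coe_toNNReal _ hq.le, div_mul_cancel₀ _ h1.ne']

/-- Closed level sets are assumed only at attained levels; homogeneity makes every nonnegative level
attained, and negative levels are trivial. -/
theorem continuous [Nonempty ι] (hf : IsTradingFunction f) (hh : HomogeneityInLiquidity f) :
    Continuous f := by
  refine OrderTopology.continuous_iff.2 fun v => ?_
  rcases lt_or_ge v 0 with hv | hv
  · have h1 : f ⁻¹' Ioi v = univ := eq_univ_of_forall fun I => hv.trans_le (hf.nonneg hh I)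
    have h2 : f ⁻¹' Iio v = ∅ := eq_empty_of_forall_notMem fun I hI =>
      lt_asymm (mem_Iio.1 hI) (hv.trans_le (hf.nonneg hh I))
    rw [h1, h2]
    exact ⟨isOpen_univ, isOpen_empty⟩
  · obtain ⟨J, hJ⟩ : ∃ J, f J = v := by
      rcases hv.eq_or_lt with rfl | hv
      · exact ⟨0, hh.map_zero⟩
      · exact (hf.exists_eq hh hv).imp fun _ h => h.2
    have h1 : f ⁻¹' Ioi v = {I | f I ≤ f J}ᶜ := by ext I; simp [hJ]
    have h2 : f ⁻¹' Iio v = {I | f J ≤ f I}ᶜ := by ext I; simp [hJ]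
    rw [h1, h2]
    exact ⟨(hf.isClosed_lower J).isOpen_compl, (hf.isClosed_upper J).isOpen_compl⟩

theorem shiftSeparable [DecidableEq ι] [Nonempty ι] (hf : IsTradingFunction f)
    (hi : Independence f) (hh : HomogeneityInLiquidity f) :
    ShiftSeparable fun x => Real.log (f (expInventory x)) where
  strictMono x y h := Real.log_lt_log (hf.pos hh (allPos_expInventory x))
    (hf.strictMono (allPos_expInventory x) (allPos_expInventory y) (expInventory_strictMono h))
  shift x t := by
    rw [expInventory_add, hh _ _ (Real.toNNReal_pos.2 (Real.exp_pos t)),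
      Real.coe_toNNReal _ (Real.exp_pos _).le, Real.log_mul (Real.exp_pos t).ne'
        (hf.pos hh (allPos_expInventory x)).ne', Real.log_exp, add_comm]
  indep i j _ x y x' y' z w h := by
    have h' := Real.log_injOn_pos (hf.pos hh (allPos_expInventory _))
      (hf.pos hh (allPos_expInventory _)) h
    have := hi {i, j} (expInventory (setPair w i x j y)) (expInventory (setPair z i x' j y'))
      (allPos_expInventory _) (allPos_expInventory _)
    rw [mix_expInventory, mix_expInventory] at this
    rw [this.1 h']

end IsTradingFunction

/-! ### CEMMs -/

section CEMM

variable [Fintype ι] {γ c : ℝ} {α : ι → ℝ} {I J : Inventory ι}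

theorem cemm_zero (c : ℝ) (α : ι → ℝ) (I : Inventory ι) :
    cemm 0 c α I = c * ∏ a, (I a : ℝ) ^ α a := if_pos rfl

theorem cemm_of_pos (hγ : 0 < γ) (c : ℝ) (α : ι → ℝ) (I : Inventory ι) :
    cemm γ c α I = c * (∑ a, α a * (I a : ℝ) ^ γ) ^ (1 / γ) := by
  rw [cemm, if_neg hγ.ne', if_neg fun h => hγ.not_gt h.1]

theorem cemm_of_allPos (hγ : γ ≠ 0) (c : ℝ) (α : ι → ℝ) (hI : AllPos I) :
    cemm γ c α I = c * (∑ a, α a * (I a : ℝ) ^ γ) ^ (1 / γ) := by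
  rw [cemm, if_neg hγ, if_neg fun ⟨_, a, ha⟩ => (hI a).ne' ha]

theorem cemm_eq_zero (hγ : γ ≤ 0) (hα : ∀ a, 0 < α a) {a : ι} (ha : I a = 0) :
    cemm γ c α I = 0 := by
  rcases hγ.eq_or_lt with rfl | hγ
  · rw [cemm_zero, Finset.prod_eq_zero (Finset.mem_univ a), mul_zero]
    rw [ha, NNReal.coe_zero, Real.zero_rpow (hα a).ne']
  · rw [cemm, if_neg hγ.ne, if_pos ⟨hγ, a, ha⟩]

theorem sum_rpow_pos [Nonempty ι] (hα : ∀ a, 0 < α a) (hI : AllPos I) (γ : ℝ) :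
    0 < ∑ a, α a * (I a : ℝ) ^ γ :=
  Finset.sum_pos (fun a _ => mul_pos (hα a) (Real.rpow_pos_of_pos (NNReal.coe_pos.2 (hI a)) _))
    Finset.univ_nonempty

/-- A CEMM is a multiple of the certainty equivalent for the utility `crra γ`. -/
theorem exists_cemm_eq [Nonempty ι] (γ c : ℝ) (hα : ∀ a, 0 < α a) (hI : AllPos I) :
    ∃ m, 0 < m ∧ cemm γ c α I = c * m ∧ crra γ m = ∑ a, α a * crra γ (I a) := by
  by_cases hγ : γ = 0
  · subst hγ
    have hp : ∀ a, 0 < (I a : ℝ) ^ α a := fun a => Real.rpow_pos_of_pos (NNReal.coe_pos.2 (hI a)) _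
    refine ⟨_, Finset.prod_pos fun a _ => hp a, cemm_zero c α I, ?_⟩
    simp only [crra, if_pos]
    rw [Real.log_prod fun a _ => (hp a).ne']
    exact Finset.sum_congr rfl fun a _ => Real.log_rpow (NNReal.coe_pos.2 (hI a)) _
  · have hS := sum_rpow_pos hα hI γ
    refine ⟨_, Real.rpow_pos_of_pos hS _, cemm_of_allPos hγ c α hI, ?_⟩
    simp only [crra, if_neg hγ]
    rw [← Real.rpow_mul hS.le, one_div_mul_cancel hγ, Real.rpow_one, Finset.sum_div]
    simp only [mul_div_assoc]

theorem cemm_pos [Nonempty ι] (hc : 0 < c) (hα : ∀ a, 0 < α a) (hI : AllPos I) :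
    0 < cemm γ c α I := by
  obtain ⟨m, hm, h, -⟩ := exists_cemm_eq γ c hα hI
  rw [h]
  exact mul_pos hc hm

theorem cemm_le_cemm_iff [Nonempty ι] (hc : 0 < c) (hα : ∀ a, 0 < α a) (hI : AllPos I)
    (hJ : AllPos J) : cemm γ c α I ≤ cemm γ c α J ↔
      ∑ a, α a * crra γ (I a) ≤ ∑ a, α a * crra γ (J a) := by
  obtain ⟨m, hm, h, hs⟩ := exists_cemm_eq γ c hα hI
  obtain ⟨m', hm', h', hs'⟩ := exists_cemm_eq γ c hα hJ
  rw [h, h', ← hs, ← hs', mul_le_mul_iff_right₀ hc]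
  exact ((crra_strictMonoOn γ).le_iff_le hm hm').symm

theorem cemm_eq_cemm_iff [Nonempty ι] (hc : 0 < c) (hα : ∀ a, 0 < α a) (hI : AllPos I)
    (hJ : AllPos J) : cemm γ c α I = cemm γ c α J ↔
      ∑ a, α a * crra γ (I a) = ∑ a, α a * crra γ (J a) := by
  rw [le_antisymm_iff, le_antisymm_iff, cemm_le_cemm_iff hc hα hI hJ, cemm_le_cemm_iff hc hα hJ hI]

theorem sum_mix_add_sum_mix (g : ι → ℝ≥0 → ℝ) (B : Set ι) (I J : Inventory ι) :
    ∑ a, g a (mix B I J a) + ∑ a, g a (mix B J I a) = ∑ a, g a (I a) + ∑ a, g a (J a) := by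
  rw [← Finset.sum_add_distrib, ← Finset.sum_add_distrib]
  refine Finset.sum_congr rfl fun a _ => ?_
  unfold mix
  split_ifs
  exacts [rfl, add_comm _ _]

/-- For an additive utility the two mixed inventories have the same total as `I` and `J`, so one
equality forces the other. -/
theorem independence_cemm [Nonempty ι] (hc : 0 < c) (hα : ∀ a, 0 < α a) :
    Independence (cemm γ c α) := fun B I J hI hJ => by
  rw [cemm_eq_cemm_iff hc hα (hI.mix B hJ) hJ, cemm_eq_cemm_iff hc hα hI (hJ.mix B hI)]
  have := sum_mix_add_sum_mix (fun a y => α a * crra γ y) B I J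
  constructor <;> intro h <;> linarith

theorem homogeneityInLiquidity_cemm (hα : ∀ a, 0 < α a) (hα1 : ∑ a, α a = 1) :
    HomogeneityInLiquidity (cemm γ c α) := fun I l hl => by
  have hl' : 0 < (l : ℝ) := NNReal.coe_pos.2 hl
  have hm : ∀ a, (((l • I) a : ℝ≥0) : ℝ) = l * I a := fun a => by
    rw [Pi.smul_apply, smul_eq_mul, NNReal.coe_mul]
  have hz : (∃ a, (l • I) a = 0) ↔ ∃ a, I a = 0 := by simp [hl.ne']
  unfold cemm
  simp_rw [hz, hm]
  split_ifs with h1 h2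
  · simp_rw [Real.mul_rpow hl'.le (NNReal.coe_nonneg _), Finset.prod_mul_distrib]
    rw [← Real.rpow_sum_of_pos hl', hα1, Real.rpow_one]
    ring
  · rw [mul_zero]
  · have : ∑ a, α a * ((l : ℝ) * I a) ^ γ = (l : ℝ) ^ γ * ∑ a, α a * (I a : ℝ) ^ γ := by
      rw [Finset.mul_sum]
      refine Finset.sum_congr rfl fun a _ => ?_
      rw [Real.mul_rpow hl'.le (NNReal.coe_nonneg _)]
      ring
    rw [this, Real.mul_rpow (Real.rpow_nonneg hl'.le _) (Finset.sum_nonneg fun a _ =>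
      mul_nonneg (hα a).le (Real.rpow_nonneg (NNReal.coe_nonneg _) _)), ← Real.rpow_mul hl'.le,
      mul_one_div_cancel h1, Real.rpow_one]
    ring

/-- For `γ ≥ 0` the formula is continuous. For `γ < 0` keeping only the term of a vanishing asset
bounds the value above by a multiple of its quantity, because `1 / γ` is negative. -/
theorem tendsto_cemm_approx [Nonempty ι] (hc : 0 < c) (hα : ∀ a, 0 < α a) (hI : ¬AllPos I) :
    Tendsto (fun n => cemm γ c α (approx I n)) atTop (𝓝 (cemm γ c α I)) := by
  rcases lt_trichotomy γ 0 with hγ | rfl | hγ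
  · obtain ⟨a, ha⟩ : ∃ a, I a = 0 := by simpa [AllPos] using hI
    rw [cemm_eq_zero hγ.le hα ha]
    have hlim : Tendsto (fun n => c * (α a ^ (1 / γ) * (approx I n a : ℝ))) atTop (𝓝 0) := by
      have h1 := (NNReal.tendsto_coe.2 (tendsto_pi_nhds.1 (tendsto_approx I) a))
      rw [ha, NNReal.coe_zero] at h1
      simpa using (h1.const_mul (α a ^ (1 / γ))).const_mul c
    refine tendsto_of_tendsto_of_tendsto_of_le_of_le tendsto_const_nhds hlim
      (fun n => (cemm_pos hc hα (allPos_approx I n)).le) fun n => ?_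
    simp only
    have hp : 0 < (approx I n a : ℝ) := NNReal.coe_pos.2 (allPos_approx I n a)
    rw [cemm_of_allPos hγ.ne c α (allPos_approx I n)]
    refine mul_le_mul_of_nonneg_left ?_ hc.le
    have e : α a ^ (1 / γ) * (approx I n a : ℝ) = (α a * (approx I n a : ℝ) ^ γ) ^ (1 / γ) := by
      rw [Real.mul_rpow (hα a).le (Real.rpow_nonneg hp.le _), ← Real.rpow_mul hp.le,
        mul_one_div_cancel hγ.ne, Real.rpow_one]
    rw [e]
    refine Real.rpow_le_rpow_of_nonpos (mul_pos (hα a) (Real.rpow_pos_of_pos hp _)) ?_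
      (one_div_neg.2 hγ).le
    exact Finset.single_le_sum (f := fun b => α b * (approx I n b : ℝ) ^ γ) (fun b _ =>
      mul_nonneg (hα b).le (Real.rpow_nonneg (NNReal.coe_nonneg _) _)) (Finset.mem_univ a)
  · have : Continuous (cemm 0 c α) := by
      rw [funext (cemm_zero c α)]
      exact continuous_const.mul (continuous_finsetProd _ fun a _ =>
        (NNReal.continuous_coe.comp (continuous_apply a)).rpow_const fun _ => Or.inr (hα a).le)
    exact (this.tendsto I).comp (tendsto_approx I)
  · have : Continuous (cemm γ c α) := by
      rw [funext (cemm_of_pos hγ c α)]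
      exact continuous_const.mul ((continuous_finsetSum _ fun a _ => continuous_const.mul
        ((NNReal.continuous_coe.comp (continuous_apply a)).rpow_const
          fun _ => Or.inr hγ.le)).rpow_const fun _ => Or.inr (one_div_pos.2 hγ).le)
    exact (this.tendsto I).comp (tendsto_approx I)

theorem IsTradingFunction.exists_isCEMM (h𝒜 : 2 < Fintype.card ι) (hf : IsTradingFunction f)
    (hi : Independence f) (hh : HomogeneityInLiquidity f) : ∃ γ, IsCEMM γ f := by
  classical
  have : Nonempty ι := Fintype.card_pos_iff.1 (by omega)
  obtain ⟨γ, α, hα, hα1, h⟩ := (hf.shiftSeparable hi hh).exists_crra h𝒜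
  have hc := hf.pos hh (allPos_expInventory (0 : ι → ℝ))
  set c := f (expInventory 0)
  have hpos : ∀ I, AllPos I → f I = cemm γ c α I := by
    intro I hI
    obtain ⟨m, hm, hm1, hm2⟩ := exists_cemm_eq γ c hα hI
    have := h (fun a => Real.log (I a)) (Real.log m) (by
      simp only [Real.exp_log hm, Real.exp_log (NNReal.coe_pos.2 (hI _)), hm2])
    rw [expInventory_log hI, ← Real.log_mul hc.ne' hm.ne'] at this
    rw [hm1]
    exact Real.log_injOn_pos (hf.pos hh hI) (mul_pos hc hm) this
  refine ⟨γ, c, α, hc, hα, hα1, funext fun I => ?_⟩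
  by_cases hI : AllPos I
  · exact hpos I hI
  · refine tendsto_nhds_unique (((hf.continuous hh).tendsto I).comp (tendsto_approx I)) ?_
    refine (tendsto_cemm_approx hc hα hI).congr fun n => ?_
    exact (hpos _ (allPos_approx I n)).symm

/-! ### Aversion to permanent loss and sufficient funds -/

theorem concaveOn_crra (hγ : γ ≤ 1) : ConcaveOn ℝ (Ioi 0) (crra γ) := by
  have hd : ∀ y ∈ Ioi (0 : ℝ), HasDerivAt (crra γ) (y ^ (γ - 1)) y := fun y hy => by
    by_cases h : γ = 0
    · have e : crra γ = Real.log := by funext y; rw [crra, if_pos h]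
      rw [e, h, zero_sub, Real.rpow_neg_one]
      exact Real.hasDerivAt_log (ne_of_gt hy)
    · have e : crra γ = fun y => y ^ γ / γ := by funext y; rw [crra, if_neg h]
      rw [e]
      refine ((Real.hasDerivAt_rpow_const (Or.inl (ne_of_gt hy))).div_const γ).congr_deriv ?_
      rw [mul_div_cancel_left₀ _ h]
  refine AntitoneOn.concaveOn_of_deriv (convex_Ioi 0)
    (fun y hy => (hd y hy).continuousAt.continuousWithinAt)
    (fun y hy => (hd y (interior_subset hy)).differentiableAt.differentiableWithinAt) ?_
  rw [interior_Ioi]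
  intro x hx y hy hxy
  rw [(hd x hx).deriv, (hd y hy).deriv]
  exact Real.rpow_le_rpow_of_nonpos hx hxy (by linarith)

theorem min_cemm_le_cemm_convexComb [Nonempty ι] (hγ : γ ≤ 1) (hc : 0 < c) (hα : ∀ a, 0 < α a)
    {a b : ℝ≥0} (hab : a + b = 1) (hI : AllPos I) (hJ : AllPos J) :
    min (cemm γ c α I) (cemm γ c α J) ≤ cemm γ c α (a • I + b • J) := by
  have hK := AllPos.convexComb hab hI hJ
  have hab' : (a : ℝ) + b = 1 := by exact_mod_cast hab
  have key : (a : ℝ) * ∑ i, α i * crra γ (I i) + b * ∑ i, α i * crra γ (J i) ≤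
      ∑ i, α i * crra γ ((a • I + b • J) i : ℝ≥0) := by
    rw [Finset.mul_sum, Finset.mul_sum, ← Finset.sum_add_distrib]
    refine Finset.sum_le_sum fun i _ => ?_
    have := (concaveOn_crra hγ).2 (NNReal.coe_pos.2 (hI i)) (NNReal.coe_pos.2 (hJ i))
      a.coe_nonneg b.coe_nonneg hab'
    simp only [smul_eq_mul] at this
    simp only [Pi.add_apply, Pi.smul_apply, smul_eq_mul, NNReal.coe_add, NNReal.coe_mul]
    have := mul_le_mul_of_nonneg_left this (hα i).le
    linarith
  have ha := a.coe_nonneg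
  have hb := b.coe_nonneg
  obtain hb' : (b : ℝ) = 1 - a := by linarith
  rw [hb'] at key hb
  rcases le_total (∑ i, α i * crra γ (I i)) (∑ i, α i * crra γ (J i)) with h | h
  · refine (min_le_left _ _).trans ((cemm_le_cemm_iff hc hα hI hK).2 (le_trans ?_ key))
    nlinarith [mul_le_mul_of_nonneg_left h hb]
  · refine (min_le_right _ _).trans ((cemm_le_cemm_iff hc hα hJ hK).2 (le_trans ?_ key))
    nlinarith [mul_le_mul_of_nonneg_left h ha]

theorem aversionToPermanentLoss_cemm [Nonempty ι] (hγ : γ ≤ 1) (hc : 0 < c) (hα : ∀ a, 0 < α a)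
    (hcont : Continuous (cemm γ c α)) : AversionToPermanentLoss (cemm γ c α) := by
  intro L I hI J hJ a b _ _ hab
  rw [mem_ofPred_eq] at hI hJ ⊢
  have h1 := (hcont.tendsto I).comp (tendsto_approx I)
  have h2 := (hcont.tendsto J).comp (tendsto_approx J)
  have h3 := (hcont.tendsto (a • I + b • J)).comp
    (((tendsto_approx I).const_smul a).add ((tendsto_approx J).const_smul b))
  exact (le_min hI hJ).trans (le_of_tendsto_of_tendsto' (h1.min h2) h3 fun n =>
    min_cemm_le_cemm_convexComb hγ hc hα hab (allPos_approx I n) (allPos_approx J n))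

theorem sufficientFunds_cemm [Nonempty ι] (hγ : γ ≤ 0) (hc : 0 < c) (hα : ∀ a, 0 < α a) :
    SufficientFunds (cemm γ c α) := fun I J h hI a => by
  by_contra ha
  have := cemm_pos (γ := γ) hc hα hI
  rw [h, cemm_eq_zero hγ hα (nonpos_iff_eq_zero.1 (not_lt.1 ha))] at this
  exact lt_irrefl _ this

/-- If `γ > 1`, two points on different axes scaled to the value `c` have a midpoint of value `c *
(2 * (1 / 2) ^ γ) ^ (1 / γ) < c`. -/
theorem le_one_of_aversionToPermanentLoss [Nontrivial ι] (hc : 0 < c) (hα : ∀ a, 0 < α a)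
    (h : AversionToPermanentLoss (cemm γ c α)) : γ ≤ 1 := by
  classical
  by_contra! hγ
  have hγ0 : 0 < γ := by linarith
  obtain ⟨p, q, hpq⟩ := exists_pair_ne ι
  let v : ι → Inventory ι := fun p => Pi.single p ((α p) ^ (-(1 / γ))).toNNReal
  have hv : ∀ p, α p * ((α p) ^ (-(1 / γ))) ^ γ = 1 := fun p => by
    rw [← Real.rpow_mul (hα p).le, neg_mul, one_div_mul_cancel hγ0.ne', Real.rpow_neg_one,
      mul_inv_cancel₀ (hα p).ne']
  have hvp : ∀ p, (v p p : ℝ) = (α p) ^ (-(1 / γ)) := fun p => by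
    simp only [v, Pi.single_eq_same]
    exact Real.coe_toNNReal _ (Real.rpow_nonneg (hα p).le _)
  have hvne : ∀ p a, a ≠ p → v p a = 0 := fun p a ha => Pi.single_eq_of_ne ha _
  have hval : ∀ p, cemm γ c α (v p) = c := fun p => by
    rw [cemm_of_pos hγ0, Finset.sum_eq_single p (fun a _ ha => by
      rw [hvne p a ha, NNReal.coe_zero, Real.zero_rpow hγ0.ne', mul_zero]) (by simp), hvp, hv,
      Real.one_rpow, mul_one]
  have hhalf : (1 / 2 : ℝ≥0) + 1 / 2 = 1 := add_halves 1
  have hconv := h (v p) (x := v p) (by rw [mem_ofPred_eq]) (y := v q)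
    (by rw [mem_ofPred_eq, hval, hval]) zero_le zero_le hhalf
  rw [mem_ofPred_eq, hval, cemm_of_pos hγ0] at hconv
  have hsum : ∑ a, α a * ((((1 / 2 : ℝ≥0) • v p + (1 / 2 : ℝ≥0) • v q) a : ℝ≥0) : ℝ) ^ γ =
      2 * (1 / 2 : ℝ) ^ γ := by
    rw [Finset.sum_eq_add p q hpq (fun a _ ha => by
      simp [hvne p a ha.1, hvne q a ha.2, Real.zero_rpow hγ0.ne']) (by simp) (by simp)]
    simp only [Pi.add_apply, Pi.smul_apply, smul_eq_mul, hvne q p hpq, hvne p q hpq.symm, mul_zero,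
      add_zero, zero_add, NNReal.coe_mul, hvp]
    rw [Real.mul_rpow (by positivity) (Real.rpow_nonneg (hα p).le _),
      Real.mul_rpow (by positivity) (Real.rpow_nonneg (hα q).le _), mul_left_comm, hv,
      mul_left_comm, hv]
    push_cast
    ring
  have hlt : 2 * (1 / 2 : ℝ) ^ γ < 1 := by
    have := Real.rpow_lt_rpow_of_exponent_gt (x := (1 / 2 : ℝ)) (by norm_num) (by norm_num) hγ
    rw [Real.rpow_one] at this
    linarith
  rw [hsum] at hconv
  have := Real.rpow_lt_one (by positivity) hlt (one_div_pos.2 hγ0)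
  nlinarith

/-- If `γ > 0`, a unit of one asset alone has positive value, and by homogeneity some positive
inventory has the same value. -/
theorem nonpos_of_sufficientFunds [Nontrivial ι] (hc : 0 < c) (hα : ∀ a, 0 < α a)
    (hf : IsTradingFunction (cemm γ c α)) (hh : HomogeneityInLiquidity (cemm γ c α))
    (h : SufficientFunds (cemm γ c α)) : γ ≤ 0 := by
  classical
  by_contra! hγ
  obtain ⟨p, q, hpq⟩ := exists_pair_ne ι
  have hpos : 0 < cemm γ c α (Pi.single p 1) := by
    rw [cemm_of_pos hγ, Finset.sum_eq_single p (fun a _ ha => by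
      rw [Pi.single_eq_of_ne ha, NNReal.coe_zero, Real.zero_rpow hγ.ne', mul_zero]) (by simp),
      Pi.single_eq_same, NNReal.coe_one, Real.one_rpow, mul_one]
    exact mul_pos hc (Real.rpow_pos_of_pos (hα p) _)
  obtain ⟨I, hI, hIv⟩ := hf.exists_eq hh hpos
  have := h I _ hIv hI q
  rw [Pi.single_eq_of_ne hpq.symm] at this
  exact lt_irrefl _ this

end CEMM

theorem inventoryElasticity_mem_Ioc_iff {γ : ℝ} :
    (γ ≠ 1 ∧ 0 < inventoryElasticity γ ∧ inventoryElasticity γ ≤ 1) ↔ γ ≤ 0 := by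
  unfold inventoryElasticity
  constructor
  · rintro ⟨-, h0, h1⟩
    have := one_div_pos.1 h0
    rw [div_le_one this] at h1
    linarith
  · intro h
    refine ⟨by linarith, one_div_pos.2 (by linarith), ?_⟩
    rw [div_le_one (by linarith)]
    linarith

end CFMM

theorem mainTheorem10 {𝒜 : Type*} [Fintype 𝒜] (h𝒜 : 2 < Fintype.card 𝒜)
    (f : CFMM.Inventory 𝒜 → ℝ) (hf : CFMM.IsTradingFunction f) :
    ((CFMM.Independence f ∧ CFMM.HomogeneityInLiquidity f ∧ CFMM.AversionToPermanentLoss f) ↔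
      ∃ γ : ℝ, CFMM.PositiveElasticity γ ∧ CFMM.IsCEMM γ f) ∧
    ((CFMM.Independence f ∧ CFMM.HomogeneityInLiquidity f ∧ CFMM.SufficientFunds f) ↔
      ∃ γ : ℝ, (γ ≠ 1 ∧ 0 < CFMM.inventoryElasticity γ ∧ CFMM.inventoryElasticity γ ≤ 1) ∧
        CFMM.IsCEMM γ f) := by
  have : Nontrivial 𝒜 := Fintype.one_lt_card_iff_nontrivial.1 (by omega)
  simp only [CFMM.inventoryElasticity_mem_Ioc_iff]
  refine ⟨⟨?_, ?_⟩, ⟨?_, ?_⟩⟩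
  · rintro ⟨hi, hh, hl⟩
    obtain ⟨γ, c, α, hc, hα, hα1, rfl⟩ := hf.exists_isCEMM h𝒜 hi hh
    exact ⟨γ, CFMM.le_one_of_aversionToPermanentLoss hc hα hl, c, α, hc, hα, hα1, rfl⟩
  · rintro ⟨γ, hγ, c, α, hc, hα, hα1, rfl⟩
    have hh := CFMM.homogeneityInLiquidity_cemm (γ := γ) (c := c) hα hα1
    exact ⟨CFMM.independence_cemm hc hα, hh,
      CFMM.aversionToPermanentLoss_cemm hγ hc hα (hf.continuous hh)⟩
  · rintro ⟨hi, hh, hl⟩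
    obtain ⟨γ, c, α, hc, hα, hα1, rfl⟩ := hf.exists_isCEMM h𝒜 hi hh
    exact ⟨γ, CFMM.nonpos_of_sufficientFunds hc hα hf hh hl, c, α, hc, hα, hα1, rfl⟩
  · rintro ⟨γ, hγ, c, α, hc, hα, hα1, rfl⟩
    exact ⟨CFMM.independence_cemm hc hα, CFMM.homogeneityInLiquidity_cemm hα hα1,
      CFMM.sufficientFunds_cemm hγ hc hα⟩
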